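/- Let $R$ and $S$ be associative rings with unit and let $C={}_SC_R$ be a faithfully semidualizing $(S,R)$-bimodule, that is: - ${}_SC$ and $C_R$ both admit projective resolutions by finitely generated projective modules (over $S$ and over $R^{op}$, respectively); - the homothety maps $S\to\operatorname{Hom}_{R^{op}}(C,C)$, $s\mapsto(c\mapsto sc)$, and $R\to\operatorname{Hom}_S(C,C)$, $r\mapsto(c\mapsto cr)$, are bijective; - $\operatorname{Ext}^i_S(C,C)=0$ and $\operatorname{Ext}^i_{R^{op}}(C,C)=0$ for all $i\ge 1$; - for every left $S$-module $N$, $\operatorname{Hom}_S(C,N)=0$ implies $N=0$, and for every right $R$-module $M$, $\operatorname{Hom}_{R^{op}}(C,M)=0$ implies $M=0$. Let the Bass class $\mathcal{B}_C(S)$ be the class of left $S$-modules $N$ such that $\operatorname{Ext}^i_S(C,N)=0$ and $\operatorname{Tor}^R_i(C,\operatorname{Hom}_S(C,N))=0$ for all $i\ge 1$, and the evaluation map $C\otimes_R\operatorname{Hom}_S(C,N)\to N$, $c\otimes f\mapsto f(c)$, is an isomorphism. Set $[\mathcal{B}_C(S)]^1=\mathcal{B}_C(S)$ and, for $n\ge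 1$, let $[\mathcal{B}_C(S)]^{n+1}$ be the class of left $S$-modules $M$ for which there is an exact sequence of left $S$-modules $$\cdots\to V_1\to V_0\to V^0\to V^1\to\cdots$$ with all $V_i$ and $V^i$ in $[\mathcal{B}_C(S)]^n$ that remains exact after applying $\operatorname{Hom}_S(C,-)$ and such that $M\cong\ker(V^0\to V^1)$. Then $[\mathcal{B}_C(S)]^n=\mathcal{B}_C(S)$ for all $n\ge 1$. -/

import Mathlib

open CategoryTheory TensorProduct

universe u

namespace FoxbyBass

/-! Right `R`-modules are left modules over `Rᵐᵒᵖ`: the right action of `r` on `c` is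
`MulOpposite.op r • c`.  An `(S, R)`-bimodule is a type with a left `S`-module structure and
a left `Rᵐᵒᵖ`-module structure that commute with each other. -/

section Tensor

variable {R : Type u} [Ring R]

/-- The subgroup of `A ⊗[ℤ] M` generated by the elements `(a r) ⊗ m - a ⊗ (r m)`, for a right
`R`-module `A` and a left `R`-module `M`. -/
def balancedRelations (R : Type u) [Ring R] (A M : Type u) [AddCommGroup A] [Module Rᵐᵒᵖ A]
    [AddCommGroup M] [Module R M] : AddSubgroup (A ⊗[ℤ] M) :=
  AddSubgroup.closure
    {x | ∃ (a : A) (r : R) (m : M), x = (MulOpposite.op r • a) ⊗ₜ[ℤ] m - a ⊗ₜ[ℤ] (r • m)}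

/-- The tensor product `A ⊗_R M` of a right and a left module over a (not necessarily
commutative) ring `R`, as an abelian group. -/
abbrev BalancedTensor (R : Type u) [Ring R] (A M : Type u) [AddCommGroup A] [Module Rᵐᵒᵖ A]
    [AddCommGroup M] [Module R M] : Type u :=
  (A ⊗[ℤ] M) ⧸ balancedRelations R A M

/-- The pure tensor `a ⊗ m` in `A ⊗_R M`. -/
def BalancedTensor.tmul (R : Type u) [Ring R] {A M : Type u} [AddCommGroup A] [Module Rᵐᵒᵖ A]
    [AddCommGroup M] [Module R M] (a : A) (m : M) : BalancedTensor R A M :=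
  QuotientAddGroup.mk (a ⊗ₜ[ℤ] m)

/-- The map `f ⊗_R M : A ⊗_R M → B ⊗_R M` induced by a map `f : A → B` of right modules. -/
def BalancedTensor.mapLeft {A B : Type u} [AddCommGroup A] [Module Rᵐᵒᵖ A]
    [AddCommGroup B] [Module Rᵐᵒᵖ B] (f : A →ₗ[Rᵐᵒᵖ] B)
    (M : Type u) [AddCommGroup M] [Module R M] :
    BalancedTensor R A M →+ BalancedTensor R B M :=
  QuotientAddGroup.map _ _
    (LinearMap.rTensor M f.toAddMonoidHom.toIntLinearMap).toAddMonoidHom (by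
      rw [balancedRelations, AddSubgroup.closure_le]
      rintro _ ⟨a, r, m, rfl⟩
      refine AddSubgroup.subset_closure ⟨f a, r, m, ?_⟩
      rw [map_sub, ← map_smul f]
      rfl)

theorem BalancedTensor.mapLeft_tmul {A B : Type u} [AddCommGroup A] [Module Rᵐᵒᵖ A]
    [AddCommGroup B] [Module Rᵐᵒᵖ B] (f : A →ₗ[Rᵐᵒᵖ] B)
    (M : Type u) [AddCommGroup M] [Module R M] (a : A) (m : M) :
    BalancedTensor.mapLeft f M (BalancedTensor.tmul R a m) = BalancedTensor.tmul R (f a) m :=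
  rfl

theorem BalancedTensor.hom_ext {A M P : Type u} [AddCommGroup A] [Module Rᵐᵒᵖ A]
    [AddCommGroup M] [Module R M] [AddCommGroup P]
    {f g : BalancedTensor R A M →+ P}
    (h : ∀ (a : A) (m : M), f (BalancedTensor.tmul R a m) = g (BalancedTensor.tmul R a m)) :
    f = g := by
  refine QuotientAddGroup.addMonoidHom_ext _ ?_
  refine AddMonoidHom.ext fun x => ?_
  induction x with
  | zero => simp
  | add x y hx hy => rw [map_add, map_add, hx, hy]
  | tmul a m => exact h a m

/-- The functor `- ⊗_R M` from right `R`-modules to abelian groups. -/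
def tensorFunctor (R : Type u) [Ring R] (M : Type u) [AddCommGroup M] [Module R M] :
    ModuleCat.{u} Rᵐᵒᵖ ⥤ AddCommGrpCat.{u} where
  obj A := AddCommGrpCat.of (BalancedTensor R A M)
  map f := AddCommGrpCat.ofHom (BalancedTensor.mapLeft f.hom M)
  map_id A := by
    apply AddCommGrpCat.hom_ext
    apply BalancedTensor.hom_ext
    intro a m
    rfl
  map_comp f g := by
    apply AddCommGrpCat.hom_ext
    apply BalancedTensor.hom_ext
    intro a m
    rfl

instance (R : Type u) [Ring R] (M : Type u) [AddCommGroup M] [Module R M] :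
    (tensorFunctor R M).Additive where
  map_add {A B f g} := by
    apply AddCommGrpCat.hom_ext
    apply BalancedTensor.hom_ext
    intro a m
    exact congrArg (QuotientAddGroup.mk (s := balancedRelations R B M))
      (TensorProduct.add_tmul (R := ℤ) (f.hom a) (g.hom a) m)

/-- `Tor_i^R(A, M)`: the `i`-th left derived functor of `- ⊗_R M`, evaluated at `A`. -/
noncomputable def Tor (R : Type u) [Ring R] (A M : Type u) [AddCommGroup A] [Module Rᵐᵒᵖ A]
    [AddCommGroup M] [Module R M] (i : ℕ) : AddCommGrpCat.{u} :=
  ((tensorFunctor R M).leftDerived i).obj (ModuleCat.of Rᵐᵒᵖ A)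

end Tensor

section Semidualizing

/-- The module `M` over `T` has a projective resolution by finitely generated projective
modules. -/
def HasFiniteTypeResolution (T : Type u) [Ring T] (M : Type u) [AddCommGroup M] [Module T M] :
    Prop :=
  ∃ P : ProjectiveResolution (ModuleCat.of T M), ∀ n, Module.Finite T (P.complex.X n)

variable (R S : Type u) [Ring R] [Ring S] (C : Type u) [AddCommGroup C] [Module S C]
  [Module Rᵐᵒᵖ C] [SMulCommClass S Rᵐᵒᵖ C]

/-- The homothety map `S → Hom_{Rᵒᵖ}(C, C)`, `s ↦ (c ↦ s c)`. -/
def leftHomothety (s : S) : C →ₗ[Rᵐᵒᵖ] C where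
  toFun c := s • c
  map_add' := smul_add s
  map_smul' r c := smul_comm s r c

/-- The homothety map `R → Hom_S(C, C)`, `r ↦ (c ↦ c r)`. -/
def rightHomothety (r : R) : C →ₗ[S] C where
  toFun c := MulOpposite.op r • c
  map_add' := smul_add _
  map_smul' s c := (smul_comm s (MulOpposite.op r) c).symm

/-- The `(S, R)`-bimodule `C` is semidualizing. -/
structure IsSemidualizing : Prop where
  finite_left : HasFiniteTypeResolution S C
  finite_right : HasFiniteTypeResolution Rᵐᵒᵖ C
  bijective_left : Function.Bijective (leftHomothety R S C)
  bijective_right : Function.Bijective (rightHomothety R S C)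
  ext_left : ∀ i : ℕ, 1 ≤ i →
    Subsingleton (Abelian.Ext (ModuleCat.of S C) (ModuleCat.of S C) i)
  ext_right : ∀ i : ℕ, 1 ≤ i →
    Subsingleton (Abelian.Ext (ModuleCat.of Rᵐᵒᵖ C) (ModuleCat.of Rᵐᵒᵖ C) i)

/-- The `(S, R)`-bimodule `C` is faithfully semidualizing. -/
structure IsFaithfullySemidualizing : Prop extends IsSemidualizing R S C where
  faithful_left : ∀ (N : Type u) [AddCommGroup N] [Module S N],
    Subsingleton (C →ₗ[S] N) → Subsingleton N
  faithful_right : ∀ (M : Type u) [AddCommGroup M] [Module Rᵐᵒᵖ M],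
    Subsingleton (C →ₗ[Rᵐᵒᵖ] M) → Subsingleton M

end Semidualizing

section Bass

variable (R S : Type u) [Ring R] [Ring S] (C : Type u) [AddCommGroup C] [Module S C]
  [Module Rᵐᵒᵖ C] [SMulCommClass S Rᵐᵒᵖ C]

/-- The abelian group `Hom_S(C, N)`, to be regarded as a left `R`-module through the right
action of `R` on `C`. -/
def HomFrom (_R S : Type u) [Ring S] (C : Type u) [AddCommGroup C] [Module S C]
    (N : Type u) [AddCommGroup N] [Module S N] : Type u :=
  C →ₗ[S] N

variable (N : Type u) [AddCommGroup N] [Module S N]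

instance : AddCommGroup (HomFrom R S C N) :=
  inferInstanceAs (AddCommGroup (C →ₗ[S] N))

/-- The left `R`-module structure `(r f)(c) = f(c r)` on `Hom_S(C, N)`. -/
instance : Module R (HomFrom R S C N) where
  smul r f := LinearMap.comp (show C →ₗ[S] N from f) (rightHomothety R S C r)
  one_smul f := LinearMap.ext fun c => by
    change (show C →ₗ[S] N from f) (MulOpposite.op (1 : R) • c) = _
    simp
  mul_smul r r' f := LinearMap.ext fun c => by
    change (show C →ₗ[S] N from f) (MulOpposite.op (r * r') • c) =
      (show C →ₗ[S] N from f) (MulOpposite.op r' • MulOpposite.op r • c)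
    rw [MulOpposite.op_mul, mul_smul]
  smul_zero r := LinearMap.ext fun c => rfl
  smul_add r f g := LinearMap.ext fun c => rfl
  add_smul r r' f := LinearMap.ext fun c => by
    change (show C →ₗ[S] N from f) (MulOpposite.op (r + r') • c) =
      (show C →ₗ[S] N from f) (MulOpposite.op r • c) +
        (show C →ₗ[S] N from f) (MulOpposite.op r' • c)
    rw [MulOpposite.op_add, add_smul, map_add]
  zero_smul f := LinearMap.ext fun c => by
    change (show C →ₗ[S] N from f) (MulOpposite.op (0 : R) • c) = 0
    rw [MulOpposite.op_zero, zero_smul, map_zero]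

/-- The evaluation map `C ⊗_ℤ Hom_S(C, N) → N`, `c ⊗ f ↦ f c`. -/
def evalTensorInt : C ⊗[ℤ] HomFrom R S C N →+ N :=
  TensorProduct.liftAddHom
    { toFun := fun c =>
        { toFun := fun f => (show C →ₗ[S] N from f) c
          map_zero' := rfl
          map_add' := fun _ _ => rfl }
      map_zero' := AddMonoidHom.ext fun f => map_zero (show C →ₗ[S] N from f)
      map_add' := fun c c' => AddMonoidHom.ext fun f => map_add (show C →ₗ[S] N from f) c c' }
    (fun n c f => by
      change (show C →ₗ[S] N from f) (n • c) = (show C →ₗ[S] N from (n • f)) c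
      rw [map_zsmul]
      rfl)

/-- The natural evaluation homomorphism `C ⊗_R Hom_S(C, N) → N`, `c ⊗ f ↦ f c`. -/
def evalMap : BalancedTensor R C (HomFrom R S C N) →+ N :=
  QuotientAddGroup.lift _ (evalTensorInt R S C N) (by
    rw [balancedRelations, AddSubgroup.closure_le]
    rintro _ ⟨c, r, f, rfl⟩
    rw [SetLike.mem_coe, AddMonoidHom.mem_ker, map_sub, sub_eq_zero]
    rfl)

theorem evalMap_tmul (c : C) (f : C →ₗ[S] N) :
    evalMap R S C N (BalancedTensor.tmul R c (show HomFrom R S C N from f)) = f c :=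
  rfl

/-- The Bass class `B_C(S)`, as a class of left `S`-modules. -/
structure BassClass (N : ModuleCat.{u} S) : Prop where
  ext_vanish : ∀ i : ℕ, 1 ≤ i → Subsingleton (Abelian.Ext (ModuleCat.of S C) N i)
  tor_vanish : ∀ i : ℕ, 1 ≤ i → Subsingleton (Tor R C (HomFrom R S C N) i)
  eval_bijective : Function.Bijective (evalMap R S C N)

end Bass

section Iteration

variable {S : Type u} [Ring S] (C : Type u) [AddCommGroup C] [Module S C]

/-- The class of modules `N` isomorphic to `ker (V⁰ → V¹)` for some exact sequence
`⋯ → V₁ → V₀ → V⁰ → V¹ → ⋯` of left `S`-modules that stays exact under `Hom_S(C, -)` and all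
of whose terms lie in the class `X`.  The terms are indexed by `ℤ`: `Vⁱ` is `V i` and `Vᵢ` is
`V (-1 - i)`. -/
def CompleteKernels (X : ObjectProperty (ModuleCat.{u} S)) : ObjectProperty (ModuleCat.{u} S) :=
  fun N => ∃ (V : ℤ → ModuleCat.{u} S) (d : ∀ i : ℤ, V i →ₗ[S] V (i + 1)),
    (∀ i, X (V i)) ∧
    (∀ i, Function.Exact (d i) (d (i + 1))) ∧
    (∀ i, Function.Exact (fun f : C →ₗ[S] V i => (d i).comp f)
      (fun f : C →ₗ[S] V (i + 1) => (d (i + 1)).comp f)) ∧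
    Nonempty (N ≃ₗ[S] LinearMap.ker (d 0))

/-- The iterated class `[X]ⁿ`: `[X]¹ = X`, and `[X]ⁿ⁺¹` consists of the kernels in complete
sequences with terms in `[X]ⁿ`.  The value at `n = 0` is a convention that is not used. -/
def iteratedClass (X : ObjectProperty (ModuleCat.{u} S)) : ℕ → ObjectProperty (ModuleCat.{u} S)
  | 0 => X
  | 1 => X
  | n + 2 => CompleteKernels C (iteratedClass X (n + 1))

end Iteration

end FoxbyBass

/-! It suffices to show that the Bass class is unchanged by one application of `CompleteKernels`;
induction on `n` does the rest. A module `N` of the Bass class is a kernel in the contractible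
complex `0 → N → N → 0`, which stays exact under every additive functor (`diskHomotopy_spec`).

Conversely, cut a complete sequence into short exact sequences `0 → K i → V i → K (i + 1) → 0`,
which `Hom_S(C, -)` keeps exact. Every `K i` is both a quotient and a submodule of a Bass module, so
the conditions can be proved for all `i` together (`bassClass_of_family`). Evaluation at `K i` is
onto since `K i` is a quotient of `V (i - 1)`, and then one-to-one by a diagram chase. The
evaluation isomorphisms identify `C ⊗ Hom_S(C, K i) → C ⊗ Hom_S(C, V i)` with the inclusion `K i → V
i`, so this map is injective and `Tor_1` vanishes. Higher `Tor` follows by shifting to the left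
along the sequence, `Ext` by shifting to the right. -/

namespace FoxbyBass

/-! ### Tensor products over a noncommutative ring -/

namespace BalancedTensor

variable {R : Type u} [Ring R] {A B : Type u} [AddCommGroup A] [Module Rᵐᵒᵖ A]
  [AddCommGroup B] [Module Rᵐᵒᵖ B] {L M N P : Type u} [AddCommGroup L] [Module R L]
  [AddCommGroup M] [Module R M] [AddCommGroup N] [Module R N] [AddCommGroup P]

theorem add_tmul (a a' : A) (m : M) : tmul R (a + a') m = tmul R a m + tmul R a' m :=
  congrArg (QuotientAddGroup.mk (s := balancedRelations R A M)) (TensorProduct.add_tmul a a' m)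

theorem tmul_add (a : A) (m m' : M) : tmul R a (m + m') = tmul R a m + tmul R a m' :=
  congrArg (QuotientAddGroup.mk (s := balancedRelations R A M)) (TensorProduct.tmul_add a m m')

theorem smul_tmul (a : A) (r : R) (m : M) :
    tmul R (MulOpposite.op r • a) m = tmul R a (r • m) := by
  refine (QuotientAddGroup.eq_iff_sub_mem).2 (AddSubgroup.subset_closure ⟨a, r, m, rfl⟩)

/-- The biadditive map `(a, m) ↦ a ⊗ m`. -/
def mk (R : Type u) [Ring R] (A M : Type u) [AddCommGroup A] [Module Rᵐᵒᵖ A]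
    [AddCommGroup M] [Module R M] : A →+ M →+ BalancedTensor R A M :=
  AddMonoidHom.mk' (fun a => AddMonoidHom.mk' (fun m => tmul R a m) (tmul_add a))
    fun a a' => AddMonoidHom.ext fun m => add_tmul a a' m

/-- The additive map out of `A ⊗_R M` given by a balanced biadditive map. -/
def lift (f : A →+ M →+ P) (hf : ∀ a (r : R) m, f (MulOpposite.op r • a) m = f a (r • m)) :
    BalancedTensor R A M →+ P :=
  QuotientAddGroup.lift _ (TensorProduct.liftAddHom f fun n a m => by
    rw [map_zsmul, map_zsmul, AddMonoidHom.smul_apply]) (by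
    rw [balancedRelations, AddSubgroup.closure_le]
    rintro _ ⟨a, r, m, rfl⟩
    rw [SetLike.mem_coe, AddMonoidHom.mem_ker, map_sub, sub_eq_zero]
    exact hf a r m)

theorem induction_on {p : BalancedTensor R A M → Prop} (x : BalancedTensor R A M)
    (zero : p 0) (tmul : ∀ a m, p (tmul R a m)) (add : ∀ x y, p x → p y → p (x + y)) : p x := by
  induction x using QuotientAddGroup.induction_on with
  | H x =>
    induction x with
    | zero => exact zero
    | tmul a m => exact tmul a m
    | add x y hx hy => exact add _ _ hx hy

/-- The map `A ⊗_R g : A ⊗_R M → A ⊗_R N` induced by a map `g : M → N` of left modules. -/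
def mapRight (A : Type u) [AddCommGroup A] [Module Rᵐᵒᵖ A] (g : M →ₗ[R] N) :
    BalancedTensor R A M →+ BalancedTensor R A N :=
  lift ((AddMonoidHom.compHom' g.toAddMonoidHom).comp (mk R A N)) fun a r m => by
    change tmul R (MulOpposite.op r • a) (g m) = tmul R a (g (r • m))
    rw [smul_tmul, map_smul]

theorem mapRight_tmul (g : M →ₗ[R] N) (a : A) (m : M) :
    mapRight A g (tmul R a m) = tmul R a (g m) :=
  rfl

theorem mapRight_comp_apply (g : M →ₗ[R] N) (h : L →ₗ[R] M) (x : BalancedTensor R A L) :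
    mapRight A (g.comp h) x = mapRight A g (mapRight A h x) :=
  DFunLike.congr_fun (hom_ext (f := mapRight A (g.comp h))
    (g := (mapRight A g).comp (mapRight A h)) fun _ _ => rfl) x

theorem mapRight_id_apply (x : BalancedTensor R A M) :
    mapRight A (LinearMap.id : M →ₗ[R] M) x = x :=
  DFunLike.congr_fun (hom_ext (f := mapRight A (LinearMap.id : M →ₗ[R] M))
    (g := AddMonoidHom.id _) fun _ _ => rfl) x

theorem mapLeft_mapRight (f : A →ₗ[Rᵐᵒᵖ] B) (g : M →ₗ[R] N) (x : BalancedTensor R A M) :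
    mapLeft f N (mapRight A g x) = mapRight B g (mapLeft f M x) :=
  DFunLike.congr_fun (hom_ext (f := (mapLeft f N).comp (mapRight A g))
    (g := (mapRight B g).comp (mapLeft f M)) fun _ _ => rfl) x

theorem mapRight_surjective (g : M →ₗ[R] N) (hg : Function.Surjective g) :
    Function.Surjective (mapRight A g) := by
  intro x
  induction x using induction_on with
  | zero => exact ⟨0, map_zero _⟩
  | tmul a n =>
    obtain ⟨m, rfl⟩ := hg n
    exact ⟨tmul R a m, rfl⟩
  | add x y hx hy =>
    obtain ⟨x, rfl⟩ := hx
    obtain ⟨y, rfl⟩ := hy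
    exact ⟨x + y, map_add _ _ _⟩

/-- `- ⊗_R M` is right exact. -/
theorem mapLeft_exact {A' : Type u} [AddCommGroup A'] [Module Rᵐᵒᵖ A'] {f : A' →ₗ[Rᵐᵒᵖ] A}
    {e : A →ₗ[Rᵐᵒᵖ] B} (hfe : Function.Exact f e) (he : Function.Surjective e) :
    Function.Exact (mapLeft f M) (mapLeft e M) := by
  -- The goal is a map `r` from `B ⊗ M` back to the cokernel of `f ⊗ M` with `r ∘ (e ⊗ M) = q`;
  -- whatever `e ⊗ M` kills is then killed by `q`.
  let q := QuotientAddGroup.mk' (mapLeft f M).range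
  let φ : A →+ M →+ BalancedTensor R A M ⧸ (mapLeft f M).range :=
    (AddMonoidHom.compHom q).comp (mk R A M)
  have hφ (a : A') (m : M) : q (tmul R (f a) m) = 0 :=
    (QuotientAddGroup.eq_zero_iff _).2 ⟨tmul R a m, rfl⟩
  let φ' : B →+ M →+ BalancedTensor R A M ⧸ (mapLeft f M).range :=
    e.toAddMonoidHom.liftOfRightInverse _ (Function.rightInverse_surjInv he) ⟨φ, by
      intro a ha
      obtain ⟨a', rfl⟩ := (hfe a).1 ha
      exact AddMonoidHom.ext (hφ a')⟩
  have hφ' (a : A) : φ' (e a) = φ a :=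
    AddMonoidHom.liftOfRightInverse_comp_apply _ _ (Function.rightInverse_surjInv he) _ a
  let r : BalancedTensor R B M →+ BalancedTensor R A M ⧸ (mapLeft f M).range :=
    lift φ' fun b r m => by
      obtain ⟨a, rfl⟩ := he b
      rw [← map_smul, hφ', hφ']
      exact congrArg q (smul_tmul a r m)
  have hr (x : BalancedTensor R A M) : r (mapLeft e M x) = q x :=
    DFunLike.congr_fun (hom_ext (f := r.comp (mapLeft e M)) (g := q) fun a m =>
      DFunLike.congr_fun (hφ' a) m) x
  intro x
  constructor
  · intro hx
    exact (QuotientAddGroup.eq_zero_iff x).1 ((hr x).symm.trans (by rw [hx, map_zero]))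
  · rintro ⟨y, rfl⟩
    exact DFunLike.congr_fun (hom_ext (f := (mapLeft e M).comp (mapLeft f M)) (g := 0)
      fun a m => (congrArg (fun b => tmul R b m) (hfe.apply_apply_eq_zero a)).trans
        (map_zero ((mk R B M).flip m))) y

/-! ### Exactness of tensoring with a projective right module -/

section Projective

/-- The additive map `f ↦ f · m` from finitely supported functions `X → Rᵐᵒᵖ`
to finitely supported functions `X → M`. -/
noncomputable def finsuppSMul (X : Type u) (m : M) : (X →₀ Rᵐᵒᵖ) →+ (X →₀ M) :=
  Finsupp.mapRange.addMonoidHom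
    (AddMonoidHom.mk' (fun r : Rᵐᵒᵖ => r.unop • m) fun r r' => by
      rw [MulOpposite.unop_add, add_smul])

theorem finsuppSMul_apply {X : Type u} (m : M) (f : X →₀ Rᵐᵒᵖ) (x : X) :
    finsuppSMul X m f x = (f x).unop • m :=
  rfl

/-- The map `A ⊗_R M → (A →₀ M)` induced by a map `A → (A →₀ Rᵐᵒᵖ)`. -/
noncomputable def toFinsupp (s : A →ₗ[Rᵐᵒᵖ] A →₀ Rᵐᵒᵖ) (M : Type u) [AddCommGroup M] [Module R M] :
    BalancedTensor R A M →+ (A →₀ M) :=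
  lift (AddMonoidHom.mk' (fun a => AddMonoidHom.mk' (fun m => finsuppSMul A m (s a))
      fun m m' => by ext; simp [finsuppSMul_apply])
      fun a a' => by ext; simp [finsuppSMul_apply])
    fun a r m => by
      ext b
      simp [finsuppSMul_apply, mul_smul]

theorem toFinsupp_tmul (s : A →ₗ[Rᵐᵒᵖ] A →₀ Rᵐᵒᵖ) (a : A) (m : M) :
    toFinsupp s M (tmul R a m) = finsuppSMul A m (s a) :=
  rfl

/-- The map `(A →₀ M) → A ⊗_R M` sending `single a m` to `a ⊗ m`. -/
noncomputable def ofFinsupp (R : Type u) [Ring R] (A M : Type u) [AddCommGroup A] [Module Rᵐᵒᵖ A]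
    [AddCommGroup M] [Module R M] : (A →₀ M) →+ BalancedTensor R A M :=
  Finsupp.liftAddHom (mk R A M)

theorem ofFinsupp_single (a : A) (m : M) : ofFinsupp R A M (Finsupp.single a m) = tmul R a m :=
  Finsupp.liftAddHom_apply_single _ _ _

theorem ofFinsupp_finsuppSMul (m : M) (f : A →₀ Rᵐᵒᵖ) :
    ofFinsupp R A M (finsuppSMul A m f) = tmul R (Finsupp.linearCombination Rᵐᵒᵖ id f) m := by
  induction f using Finsupp.induction_linear with
  | zero =>
    rw [map_zero, map_zero, map_zero]
    exact (map_zero ((mk R A M).flip m)).symm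
  | add f g hf hg => rw [map_add, map_add, map_add, add_tmul, hf, hg]
  | single a r =>
    have : finsuppSMul A m (Finsupp.single a r) = Finsupp.single a (r.unop • m) :=
      Finsupp.mapRange_single (hf := map_zero _)
    rw [this, ofFinsupp_single, ← smul_tmul, Finsupp.linearCombination_single]
    rfl

/-- A splitting `s` of the free cover of `A` makes `A ⊗ M` a retract of `A →₀ M`, naturally in `M`.
Injectivity and exactness are evident for `A →₀ M` and pass to the retract. -/
theorem ofFinsupp_toFinsupp {s : A →ₗ[Rᵐᵒᵖ] A →₀ Rᵐᵒᵖ}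
    (hs : Function.LeftInverse (Finsupp.linearCombination Rᵐᵒᵖ id) s) (x : BalancedTensor R A M) :
    ofFinsupp R A M (toFinsupp s M x) = x :=
  DFunLike.congr_fun (hom_ext (f := (ofFinsupp R A M).comp (toFinsupp s M))
    (g := AddMonoidHom.id _) fun a m => by
      change ofFinsupp R A M (finsuppSMul A m (s a)) = tmul R a m
      rw [ofFinsupp_finsuppSMul, hs]) x

theorem toFinsupp_mapRight (s : A →ₗ[Rᵐᵒᵖ] A →₀ Rᵐᵒᵖ) (g : M →ₗ[R] N)
    (x : BalancedTensor R A M) :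
    toFinsupp s N (mapRight A g x) = Finsupp.mapRange.addMonoidHom g.toAddMonoidHom
      (toFinsupp s M x) :=
  DFunLike.congr_fun (hom_ext (f := (toFinsupp s N).comp (mapRight A g))
    (g := (Finsupp.mapRange.addMonoidHom g.toAddMonoidHom).comp (toFinsupp s M)) fun a m => by
      ext b
      simp [mapRight_tmul, toFinsupp_tmul, finsuppSMul_apply]) x

theorem mapRight_ofFinsupp (g : M →ₗ[R] N) (x : A →₀ M) :
    mapRight A g (ofFinsupp R A M x) =
      ofFinsupp R A N (Finsupp.mapRange.addMonoidHom g.toAddMonoidHom x) := by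
  induction x using Finsupp.induction_linear with
  | zero => simp
  | add x y hx hy => simp only [map_add, hx, hy]
  | single a m =>
    rw [ofFinsupp_single, mapRight_tmul, Finsupp.mapRange.addMonoidHom_apply,
      Finsupp.mapRange_single, ofFinsupp_single]
    rfl

variable [Module.Projective Rᵐᵒᵖ A]

theorem mapRight_injective (g : M →ₗ[R] N) (hg : Function.Injective g) :
    Function.Injective (mapRight A g) := by
  obtain ⟨s, hs⟩ := Module.Projective.out (R := Rᵐᵒᵖ) (P := A)
  intro x y hxy
  have h := congrArg (toFinsupp s N) hxy
  rw [toFinsupp_mapRight, toFinsupp_mapRight] at h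
  rw [← ofFinsupp_toFinsupp hs x, ← ofFinsupp_toFinsupp hs y,
    Finsupp.mapRange_injective (g : M → N) (map_zero g) hg h]

theorem mapRight_exact {f : L →ₗ[R] M} {g : M →ₗ[R] N} (hfg : Function.Exact f g) :
    Function.Exact (mapRight A f) (mapRight A g) := by
  obtain ⟨s, hs⟩ := Module.Projective.out (R := Rᵐᵒᵖ) (P := A)
  intro x
  constructor
  · intro hx
    have h := congrArg (toFinsupp s N) hx
    rw [toFinsupp_mapRight, map_zero] at h
    have h' (a : A) : ∃ l, f l = toFinsupp s M x a := (hfg _).1 (DFunLike.congr_fun h a)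
    have hmem : toFinsupp s M x ∈ Set.range (Finsupp.mapRange f (map_zero f) : (A →₀ L) → _) := by
      rw [Finsupp.range_mapRange]
      exact fun a => h' a
    obtain ⟨y, hy⟩ := hmem
    refine ⟨ofFinsupp R A L y, ?_⟩
    rw [mapRight_ofFinsupp]
    exact (congrArg _ hy).trans (ofFinsupp_toFinsupp hs x)
  · rintro ⟨y, rfl⟩
    exact DFunLike.congr_fun (hom_ext (f := (mapRight A g).comp (mapRight A f)) (g := 0)
      fun a m => (congrArg (tmul R a) (hfg.apply_apply_eq_zero m)).trans
        (map_zero (mk R A N a))) y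

end Projective

end BalancedTensor

/-! ### Vanishing of Tor through projective resolutions -/

section Tor

variable {R : Type u} [Ring R]

-- This turns the vanishing of `Tor` into an elementwise exactness statement, so that dimension
-- shifting becomes a diagram chase with no long exact sequence.
open BalancedTensor in
theorem subsingleton_tor_succ_iff {A : Type u} [AddCommGroup A] [Module Rᵐᵒᵖ A]
    (P : ProjectiveResolution (ModuleCat.of Rᵐᵒᵖ A)) (M : Type u) [AddCommGroup M] [Module R M]
    (j : ℕ) :
    Subsingleton (Tor R A M (j + 1)) ↔
      Function.Exact (mapLeft (P.complex.d (j + 2) (j + 1)).hom M)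
        (mapLeft (P.complex.d (j + 1) j).hom M) := by
  have h : Limits.IsZero (Tor R A M (j + 1)) ↔
      (((tensorFunctor R M).mapHomologicalComplex _).obj P.complex).ExactAt (j + 1) := by
    rw [HomologicalComplex.exactAt_iff_isZero_homology]
    exact (P.isoLeftDerivedObj (tensorFunctor R M) (j + 1)).isZero_iff
  rw [← AddCommGrpCat.isZero_iff_subsingleton, h,
    HomologicalComplex.exactAt_iff' _ (j + 2) (j + 1) j (by simp) (by simp),
    ShortComplex.ab_exact_iff_function_exact]
  rfl

theorem ProjectiveResolution.exact_hom₀ {T : Type u} [Ring T] {A : ModuleCat.{u} T}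
    (P : ProjectiveResolution A) :
    Function.Exact (P.complex.d 1 0).hom (show P.complex.X 0 ⟶ A from P.π.f 0).hom :=
  (ShortComplex.ShortExact.moduleCat_exact_iff_function_exact _).1 P.exact₀

theorem ProjectiveResolution.surjective_hom₀ {T : Type u} [Ring T] {A : ModuleCat.{u} T}
    (P : ProjectiveResolution A) :
    Function.Surjective (show P.complex.X 0 ⟶ A from P.π.f 0).hom :=
  (ModuleCat.epi_iff_surjective _).1 (inferInstanceAs (Epi (P.π.f 0)))

open BalancedTensor in
/-- One step of dimension shifting for the homology of `X ⊗_R -`. -/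
theorem exact_mapLeft_of_exact {X₀ X₁ X₂ X₃ : Type u} [AddCommGroup X₀] [Module Rᵐᵒᵖ X₀]
    [AddCommGroup X₁] [Module Rᵐᵒᵖ X₁] [AddCommGroup X₂] [Module Rᵐᵒᵖ X₂]
    [AddCommGroup X₃] [Module Rᵐᵒᵖ X₃] [Module.Projective Rᵐᵒᵖ X₁]
    {d₃ : X₃ →ₗ[Rᵐᵒᵖ] X₂} {d₂ : X₂ →ₗ[Rᵐᵒᵖ] X₁} {d₁ : X₁ →ₗ[Rᵐᵒᵖ] X₀}
    (h₁₂ : ∀ x, d₁ (d₂ x) = 0) (h₂₃ : ∀ x, d₂ (d₃ x) = 0)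
    {K V Q : Type u} [AddCommGroup K] [Module R K] [AddCommGroup V] [Module R V]
    [AddCommGroup Q] [Module R Q] {f : K →ₗ[R] V} {g : V →ₗ[R] Q}
    (hfg : Function.Exact f g) (hg : Function.Surjective g)
    (hf : Function.Injective (mapRight X₀ f))
    (hK : Function.Exact (mapLeft d₂ K) (mapLeft d₁ K))
    (hV : Function.Exact (mapLeft d₃ V) (mapLeft d₂ V)) :
    Function.Exact (mapLeft d₃ Q) (mapLeft d₂ Q) := by
  have hcomp {A B D : Type u} [AddCommGroup A] [Module Rᵐᵒᵖ A] [AddCommGroup B]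
      [Module Rᵐᵒᵖ B] [AddCommGroup D] [Module Rᵐᵒᵖ D] {a : A →ₗ[Rᵐᵒᵖ] B} {b : B →ₗ[Rᵐᵒᵖ] D}
      (hab : ∀ x, b (a x) = 0) (M : Type u) [AddCommGroup M] [Module R M]
      (x : BalancedTensor R A M) : mapLeft b M (mapLeft a M x) = 0 :=
    DFunLike.congr_fun (hom_ext (f := (mapLeft b M).comp (mapLeft a M)) (g := 0)
      fun x m => (congrArg (fun y => tmul R y m) (hab x)).trans
        (map_zero ((mk R D M).flip m))) x
  have hfgC (x : BalancedTensor R X₂ K) : mapRight X₂ g (mapRight X₂ f x) = 0 :=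
    DFunLike.congr_fun (hom_ext (f := (mapRight X₂ g).comp (mapRight X₂ f)) (g := 0)
      fun a m => (congrArg (tmul R a) (hfg.apply_apply_eq_zero m)).trans
        (map_zero (mk R X₂ Q a))) x
  intro x
  refine ⟨fun hx => ?_, ?_⟩
  -- Lift the cycle to `X₂ ⊗ V`. The boundary of the lift comes from some `y` in `X₁ ⊗ K`, which is
  -- a cycle by `hf`, hence the boundary of some `z`. Subtracting the image of `z` makes the lift a
  -- cycle, hence a boundary by `hV`.
  · obtain ⟨x, rfl⟩ := mapRight_surjective g hg x
    rw [mapLeft_mapRight] at hx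
    obtain ⟨y, hy⟩ := (mapRight_exact hfg _).1 hx
    have hy' : mapLeft d₁ K y = 0 := by
      apply hf
      rw [← mapLeft_mapRight, hy, hcomp h₁₂, map_zero]
    obtain ⟨z, rfl⟩ := (hK y).1 hy'
    obtain ⟨w, hw⟩ := (hV (x - mapRight X₂ f z)).1 (by
      rw [map_sub, mapLeft_mapRight, hy, sub_self])
    refine ⟨mapRight X₃ g w, ?_⟩
    rw [mapLeft_mapRight, hw, map_sub, hfgC, sub_zero]
  · rintro ⟨y, rfl⟩
    exact hcomp h₂₃ Q y

end Tor

/-! ### The functor `Hom_S(C, -)` and evaluation -/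

section HomFrom

variable {R S : Type u} [Ring R] [Ring S] {C : Type u} [AddCommGroup C] [Module S C]
  [Module Rᵐᵒᵖ C] [SMulCommClass S Rᵐᵒᵖ C] {K N Q : Type u} [AddCommGroup K] [Module S K]
  [AddCommGroup N] [Module S N] [AddCommGroup Q] [Module S Q]

/-- The `R`-linear map `Hom_S(C, N) → Hom_S(C, Q)` induced by `g : N → Q`. -/
def HomFrom.map (R : Type u) [Ring R] (C : Type u) [AddCommGroup C] [Module S C]
    [Module Rᵐᵒᵖ C] [SMulCommClass S Rᵐᵒᵖ C] (g : N →ₗ[S] Q) :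
    HomFrom R S C N →ₗ[R] HomFrom R S C Q where
  toFun f := g.comp (show C →ₗ[S] N from f)
  map_add' f f' := LinearMap.comp_add (show C →ₗ[S] N from f) (show C →ₗ[S] N from f') g
  map_smul' _ _ := rfl

theorem HomFrom.map_exact {f : K →ₗ[S] N} {g : N →ₗ[S] Q} (hf : Function.Injective f)
    (hfg : Function.Exact f g) : Function.Exact (HomFrom.map R C f) (HomFrom.map R C g) := by
  intro h
  constructor
  · intro hh
    have hh' (c : C) : ∃ k, f k = (show C →ₗ[S] N from h) c :=
      (hfg _).1 (LinearMap.congr_fun (show g.comp (show C →ₗ[S] N from h) = 0 from hh) c)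
    let e := LinearEquiv.ofInjective f hf
    refine ⟨e.symm.toLinearMap.comp
      (LinearMap.codRestrict (LinearMap.range f) (show C →ₗ[S] N from h) hh'), ?_⟩
    refine LinearMap.ext fun c => ?_
    exact congrArg Subtype.val (e.apply_symm_apply ⟨_, hh' c⟩)
  · rintro ⟨k, rfl⟩
    exact LinearMap.ext fun c => hfg.apply_apply_eq_zero _

theorem evalMap_mapRight (g : N →ₗ[S] Q) (x : BalancedTensor R C (HomFrom R S C N)) :
    evalMap R S C Q (BalancedTensor.mapRight C (HomFrom.map R C g) x) = g (evalMap R S C N x) :=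
  DFunLike.congr_fun (BalancedTensor.hom_ext
    (f := (evalMap R S C Q).comp (BalancedTensor.mapRight C (HomFrom.map R C g)))
    (g := g.toAddMonoidHom.comp (evalMap R S C N)) fun _ _ => rfl) x

theorem evalMap_surjective_of_surjective {g : N →ₗ[S] Q} (hg : Function.Surjective g)
    (hN : Function.Surjective (evalMap R S C N)) : Function.Surjective (evalMap R S C Q) := by
  intro q
  obtain ⟨n, rfl⟩ := hg q
  obtain ⟨x, rfl⟩ := hN n
  exact ⟨_, evalMap_mapRight g x⟩

/-- A four-lemma chase: an element killed by evaluation lifts to `C ⊗ Hom_S(C, N)`, the lift is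
shown to come from `C ⊗ Hom_S(C, K)`, and such elements die in `C ⊗ Hom_S(C, Q)`. -/
theorem evalMap_injective_of_exact {f : K →ₗ[S] N} {g : N →ₗ[S] Q} (hfg : Function.Exact f g)
    (hg : Function.Surjective (HomFrom.map R C g))
    (hK : Function.Surjective (evalMap R S C K)) (hN : Function.Injective (evalMap R S C N)) :
    Function.Injective (evalMap R S C Q) := by
  rw [injective_iff_map_eq_zero]
  intro x hx
  obtain ⟨x, rfl⟩ := BalancedTensor.mapRight_surjective _ hg x
  rw [evalMap_mapRight] at hx
  obtain ⟨k, hk⟩ := (hfg _).1 hx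
  obtain ⟨y, rfl⟩ := hK k
  rw [← evalMap_mapRight] at hk
  rw [← hN hk, ← BalancedTensor.mapRight_comp_apply]
  have : (HomFrom.map R C g).comp (HomFrom.map R C f) = 0 :=
    LinearMap.ext fun h => LinearMap.ext fun c => hfg.apply_apply_eq_zero _
  rw [this]
  exact DFunLike.congr_fun (BalancedTensor.hom_ext (f := BalancedTensor.mapRight C
    (0 : HomFrom R S C K →ₗ[R] HomFrom R S C Q)) (g := 0)
    fun c _ => map_zero (BalancedTensor.mk R C _ c)) y

end HomFrom

/-! ### Syzygies of complete sequences -/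

section Bass

variable {R S : Type u} [Ring R] [Ring S] {C : Type u} [AddCommGroup C] [Module S C]
  [Module Rᵐᵒᵖ C] [SMulCommClass S Rᵐᵒᵖ C]

-- Each class in `Ext X T.X₁ (n + 1)` is a connecting image, and the connecting map vanishes on
-- whatever lifts to `T.X₂`.
open Abelian in
theorem subsingleton_ext_succ_of_shortExact {T : ShortComplex (ModuleCat.{u} S)}
    (hT : T.ShortExact) (X : ModuleCat.{u} S) (n : ℕ)
    (h₃ : ∀ x : Ext X T.X₃ n, ∃ y : Ext X T.X₂ n, y.comp (Ext.mk₀ T.g) (add_zero n) = x)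
    (h₂ : Subsingleton (Ext X T.X₂ (n + 1))) : Subsingleton (Ext X T.X₁ (n + 1)) := by
  refine subsingleton_of_forall_eq 0 fun x => ?_
  obtain ⟨y, rfl⟩ := Ext.covariant_sequence_exact₁ X hT x (Subsingleton.elim _ _) rfl
  obtain ⟨z, rfl⟩ := h₃ y
  rw [Ext.comp_assoc_of_second_deg_zero, hT.comp_extClass, Ext.comp_zero]

open Abelian in
theorem subsingleton_ext_of_family {K V : ℤ → ModuleCat.{u} S} (X : ModuleCat.{u} S)
    (f : ∀ i, K i ⟶ V i) (g : ∀ i, V i ⟶ K (i + 1)) (w : ∀ i, f i ≫ g i = 0)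
    (hT : ∀ i, (ShortComplex.mk (f i) (g i) (w i)).ShortExact)
    (hX : ∀ i (h : X ⟶ K (i + 1)), ∃ h' : X ⟶ V i, h' ≫ g i = h)
    (hV : ∀ i (n : ℕ), Subsingleton (Ext X (V i) (n + 1))) (n : ℕ) (i : ℤ) :
    Subsingleton (Ext X (K i) (n + 1)) := by
  induction n generalizing i with
  | zero =>
    refine subsingleton_ext_succ_of_shortExact (hT i) X 0 (fun x => ?_) (hV i 0)
    obtain ⟨h, rfl⟩ := Ext.addEquiv₀.symm.surjective x
    obtain ⟨h', rfl⟩ := hX i h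
    exact ⟨Ext.mk₀ h', Ext.mk₀_comp_mk₀ _ _⟩
  | succ n ih =>
    have := ih (i + 1)
    exact subsingleton_ext_succ_of_shortExact (hT i) X (n + 1)
      (fun x => ⟨0, Subsingleton.elim (α := Ext X (K (i + 1)) (n + 1)) _ _⟩) (hV i (n + 1))

/-- The syzygies of a complete sequence of modules in the Bass class that remains exact under
`Hom_S(C, -)` are in the Bass class. -/
theorem bassClass_of_family {K V : ℤ → ModuleCat.{u} S} (f : ∀ i, K i →ₗ[S] V i)
    (g : ∀ i, V i →ₗ[S] K (i + 1)) (hf : ∀ i, Function.Injective (f i))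
    (hfg : ∀ i, Function.Exact (f i) (g i)) (hg : ∀ i, Function.Surjective (g i))
    (hC : ∀ i, Function.Surjective (HomFrom.map R C (g i)))
    (hV : ∀ i, BassClass R S C (V i)) (i : ℤ) : BassClass R S C (K i) := by
  have surj (i : ℤ) : Function.Surjective (evalMap R S C (K i)) := by
    -- The sequence is unbounded to the left, so every syzygy is a quotient of the preceding term.
    obtain ⟨i, rfl⟩ : ∃ j, i = j + 1 := ⟨i - 1, by simp⟩
    exact evalMap_surjective_of_surjective (hg i) (hV i).eval_bijective.2
  have bij (i : ℤ) : Function.Bijective (evalMap R S C (K i)) := by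
    refine ⟨?_, surj i⟩
    obtain ⟨i, rfl⟩ : ∃ j, i = j + 1 := ⟨i - 1, by simp⟩
    exact evalMap_injective_of_exact (hfg i) (hC i) (surj i) (hV i).eval_bijective.1
  let P := projectiveResolution (ModuleCat.of Rᵐᵒᵖ C)
  have proj (j : ℕ) : Module.Projective Rᵐᵒᵖ (P.complex.X j) :=
    (IsProjective.iff_projective _).2 (P.projective j)
  have dd (j k l : ℕ) (x : P.complex.X j) : (P.complex.d k l).hom ((P.complex.d j k).hom x) = 0 :=
    LinearMap.congr_fun (ModuleCat.hom_ext_iff.1 (P.complex.d_comp_d j k l)) x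
  have tor (j : ℕ) (i : ℤ) : Subsingleton (Tor R C (HomFrom R S C (K i)) (j + 1)) := by
    induction j generalizing i with
    | zero =>
      obtain ⟨i, rfl⟩ : ∃ j, i = j + 1 := ⟨i - 1, by simp⟩
      rw [subsingleton_tor_succ_iff P]
      -- By naturality of evaluation this map is `f i` up to the bijections `bij i` and evaluation
      -- at `V i`.
      have inj : Function.Injective (BalancedTensor.mapRight C (HomFrom.map R C (f i))) := by
        intro x y hxy
        apply (bij i).1
        apply hf i
        rw [← evalMap_mapRight, hxy, evalMap_mapRight]
      -- Here `X₀` is `C` and `d₁` is the augmentation, so the hypothesis on `K` is right exactness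
      -- of the tensor product.
      exact exact_mapLeft_of_exact (ProjectiveResolution.exact_hom₀ P).apply_apply_eq_zero
        (dd 2 1 0) (HomFrom.map_exact (hf i) (hfg i)) (hC i) inj
        (BalancedTensor.mapLeft_exact (ProjectiveResolution.exact_hom₀ P)
          (ProjectiveResolution.surjective_hom₀ P))
        ((subsingleton_tor_succ_iff P _ 0).1 ((hV i).tor_vanish 1 le_rfl))
    | succ j ih =>
      obtain ⟨i, rfl⟩ : ∃ j, i = j + 1 := ⟨i - 1, by simp⟩
      rw [subsingleton_tor_succ_iff P]
      -- Now `X₀` is the projective module `P.complex.X j`, so tensoring with it preserves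
      -- injections, and the hypothesis on `K` is the vanishing one degree lower.
      refine exact_mapLeft_of_exact (dd _ _ j) (dd _ _ _) (HomFrom.map_exact (hf i) (hfg i))
        (hC i) (BalancedTensor.mapRight_injective _ fun h h' e => LinearMap.ext fun c => hf i ?_)
        ((subsingleton_tor_succ_iff P _ _).1 (ih i))
        ((subsingleton_tor_succ_iff P _ _).1 ((hV i).tor_vanish _ (by lia)))
      exact LinearMap.congr_fun (show (f i).comp (show C →ₗ[S] K i from h) =
        (f i).comp (show C →ₗ[S] K i from h') from e) c
  have w (i : ℤ) : ModuleCat.ofHom (f i) ≫ ModuleCat.ofHom (g i) = 0 :=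
    ModuleCat.hom_ext (LinearMap.ext (hfg i).apply_apply_eq_zero)
  have ext (n : ℕ) (i : ℤ) : Subsingleton (Abelian.Ext (ModuleCat.of S C) (K i) (n + 1)) :=
    subsingleton_ext_of_family (ModuleCat.of S C) (fun i => ModuleCat.ofHom (f i))
      (fun i => ModuleCat.ofHom (g i)) w
      (fun i =>
        { exact := (ShortComplex.ShortExact.moduleCat_exact_iff_function_exact _).2 (hfg i)
          mono_f := (ModuleCat.mono_iff_injective _).2 (hf i)
          epi_g := (ModuleCat.epi_iff_surjective _).2 (hg i) })
      (fun i h => by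
        obtain ⟨h', hh⟩ := hC i h.hom
        exact ⟨ModuleCat.ofHom h', ModuleCat.hom_ext hh⟩)
      (fun i n => (hV i).ext_vanish _ (by lia)) n i
  refine ⟨fun n hn => ?_, fun n hn => ?_, bij i⟩
  · obtain ⟨n, rfl⟩ := Nat.exists_eq_add_of_le' hn
    exact ext n i
  · obtain ⟨n, rfl⟩ := Nat.exists_eq_add_of_le' hn
    exact tor n i

end Bass

/-! ### Retracts of modules in the Bass class -/

section Retract

variable {R S : Type u} [Ring R] [Ring S] {C : Type u} [AddCommGroup C] [Module S C]
  [Module Rᵐᵒᵖ C] [SMulCommClass S Rᵐᵒᵖ C]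

/-- All three conditions are natural in the module, so they pass to retracts. This covers isomorphic
copies and the zero module at once. -/
theorem BassClass.of_retract {N M : ModuleCat.{u} S} (hM : BassClass R S C M) (i : N →ₗ[S] M)
    (r : M →ₗ[S] N) (hri : ∀ x, r (i x) = x) : BassClass R S C N := by
  have hri' : (HomFrom.map R C r).comp (HomFrom.map R C i) = LinearMap.id :=
    LinearMap.ext fun f => LinearMap.ext fun c => hri _
  have hmap (A : Type u) [AddCommGroup A] [Module Rᵐᵒᵖ A]
      (x : BalancedTensor R A (HomFrom R S C N)) : BalancedTensor.mapRight A (HomFrom.map R C r)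
        (BalancedTensor.mapRight A (HomFrom.map R C i) x) = x := by
    rw [← BalancedTensor.mapRight_comp_apply, hri', BalancedTensor.mapRight_id_apply]
  refine ⟨fun n hn => ?_, fun n hn => ?_, ?_, fun n => ?_⟩
  · have := hM.ext_vanish n hn
    have hir : ModuleCat.ofHom i ≫ ModuleCat.ofHom r = 𝟙 N :=
      ModuleCat.hom_ext (LinearMap.ext hri)
    refine subsingleton_of_forall_eq 0 fun x => ?_
    rw [← x.comp_mk₀_id, ← hir, ← Abelian.Ext.mk₀_comp_mk₀,
      ← Abelian.Ext.comp_assoc_of_third_deg_zero,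
      Subsingleton.elim (x.comp (Abelian.Ext.mk₀ (ModuleCat.ofHom i)) (add_zero n)) 0,
      Abelian.Ext.zero_comp]
  · obtain ⟨n, rfl⟩ := Nat.exists_eq_add_of_le' hn
    have h := hM.tor_vanish _ hn
    let P := projectiveResolution (ModuleCat.of Rᵐᵒᵖ C)
    rw [subsingleton_tor_succ_iff P] at h ⊢
    intro x
    refine ⟨fun hx => ?_, ?_⟩
    · obtain ⟨y, hy⟩ := (h (BalancedTensor.mapRight _ (HomFrom.map R C i) x)).1 (by
        rw [BalancedTensor.mapLeft_mapRight, hx, map_zero])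
      refine ⟨BalancedTensor.mapRight _ (HomFrom.map R C r) y, ?_⟩
      rw [BalancedTensor.mapLeft_mapRight, hy, hmap]
    · rintro ⟨y, rfl⟩
      rw [← hmap _ y, BalancedTensor.mapLeft_mapRight, BalancedTensor.mapLeft_mapRight,
        h.apply_apply_eq_zero, map_zero]
  · rw [injective_iff_map_eq_zero]
    intro x hx
    rw [← hmap C x, hM.eval_bijective.1 (a₁ := BalancedTensor.mapRight C (HomFrom.map R C i) x)
      (a₂ := 0) (by rw [evalMap_mapRight, hx, map_zero, map_zero]), map_zero]
  · obtain ⟨y, hy⟩ := hM.eval_bijective.2 (i n)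
    exact ⟨BalancedTensor.mapRight C (HomFrom.map R C r) y, by rw [evalMap_mapRight, hy, hri]⟩

end Retract

/-! ### Disk complexes and stability of the Bass class -/

section CompleteKernels

variable {S : Type u} [Ring S] {C : Type u} [AddCommGroup C] [Module S C]

/-- The terms of the complex `⋯ → 0 → M → M → 0 → ⋯`, concentrated in degrees `-1` and `0`. -/
abbrev DiskTerm (M : Type u) (i : ℤ) : Type u :=
  PLift (i = 0 ∨ i = -1) → M

variable {M : Type u} [AddCommGroup M] [Module S M]

variable (S M) in
/-- The differential of the complex `⋯ → 0 → M → M → 0 → ⋯`. -/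
def diskDifferential (i : ℤ) : DiskTerm M i →ₗ[S] DiskTerm M (i + 1) where
  toFun f _ := if h : i = -1 then f ⟨Or.inr h⟩ else 0
  map_add' f g := by
    ext
    dsimp
    split_ifs <;> simp
  map_smul' s f := by
    ext
    dsimp
    split_ifs <;> simp

variable (S M) in
/-- A contracting homotopy of the complex `⋯ → 0 → M → M → 0 → ⋯`. -/
def diskHomotopy (i : ℤ) : DiskTerm M (i + 1) →ₗ[S] DiskTerm M i where
  toFun f _ := if h : i = -1 then f ⟨Or.inl (by lia)⟩ else 0
  map_add' f g := by
    ext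
    dsimp
    split_ifs <;> simp
  map_smul' s f := by
    ext
    dsimp
    split_ifs <;> simp

theorem diskDifferential_comp (i : ℤ) (f : DiskTerm M i) :
    diskDifferential S M (i + 1) (diskDifferential S M i f) = 0 := by
  ext
  simp only [diskDifferential, LinearMap.coe_mk, AddHom.coe_mk, Pi.zero_apply]
  split_ifs <;> first | rfl | lia

/-- Composing with the homotopy also contracts the complex after `Hom_S(C, -)`, so both exactness
requirements follow from this identity. -/
theorem diskHomotopy_spec (i : ℤ) (f : DiskTerm M (i + 1)) :
    diskDifferential S M i (diskHomotopy S M i f) +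
      diskHomotopy S M (i + 1) (diskDifferential S M (i + 1) f) = f := by
  ext ⟨h⟩
  simp only [diskDifferential, diskHomotopy, LinearMap.coe_mk, AddHom.coe_mk, Pi.add_apply]
  split_ifs <;> first | lia | simp

theorem diskDifferential_exact (i : ℤ) :
    Function.Exact (diskDifferential S M i) (diskDifferential S M (i + 1)) := by
  intro f
  refine ⟨fun hf => ⟨diskHomotopy S M i f, ?_⟩, ?_⟩
  · have := diskHomotopy_spec (S := S) i f
    rwa [hf, map_zero, add_zero] at this
  · rintro ⟨f, rfl⟩
    exact diskDifferential_comp i f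

theorem diskDifferential_comp_exact (i : ℤ) :
    Function.Exact (fun f : C →ₗ[S] DiskTerm M i => (diskDifferential S M i).comp f)
      (fun f : C →ₗ[S] DiskTerm M (i + 1) => (diskDifferential S M (i + 1)).comp f) := by
  intro f
  refine ⟨fun hf => ⟨(diskHomotopy S M i).comp f, LinearMap.ext fun c => ?_⟩, ?_⟩
  · have := diskHomotopy_spec (S := S) i (f c)
    rwa [show diskDifferential S M (i + 1) (f c) = 0 from LinearMap.congr_fun hf c, map_zero,
      add_zero] at this
  · rintro ⟨f, rfl⟩
    exact LinearMap.ext fun c => diskDifferential_comp (S := S) i (f c)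

variable (S M) in
/-- The module `M` is the kernel of the differential of its disk complex in degree `0`. -/
def diskKernelEquiv : M ≃ₗ[S] LinearMap.ker (diskDifferential S M 0) where
  toFun m := ⟨fun _ => m, by ext; simp [diskDifferential]⟩
  map_add' _ _ := rfl
  map_smul' _ _ := rfl
  invFun f := f.1 ⟨Or.inl rfl⟩
  left_inv _ := rfl
  right_inv _ := rfl

variable {R : Type u} [Ring R] [Module Rᵐᵒᵖ C] [SMulCommClass S Rᵐᵒᵖ C]

/-- Functions out of a proposition form a copy of `N` or the zero module, without casts between
degrees; both are retracts of `N`. -/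
theorem BassClass.diskTerm {N : ModuleCat.{u} S} (hN : BassClass R S C N) (i : ℤ) :
    BassClass R S C (ModuleCat.of S (DiskTerm N i)) := by
  by_cases h : i = 0 ∨ i = -1
  · exact hN.of_retract (LinearMap.proj ⟨h⟩) (LinearMap.pi fun _ => LinearMap.id) fun _ => rfl
  · exact hN.of_retract 0 0 fun x => funext fun h' => absurd h'.down h

theorem completeKernels_bassClass :
    CompleteKernels C (BassClass R S C) = BassClass R S C := by
  ext N
  constructor
  · rintro ⟨V, d, hV, hd, hCd, ⟨e⟩⟩
    have hg (i : ℤ) (x : V i) : d i x ∈ LinearMap.ker (d (i + 1)) :=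
      (hd i).apply_apply_eq_zero x
    refine BassClass.of_retract (bassClass_of_family (R := R) (C := C)
      (K := fun i => ModuleCat.of S (LinearMap.ker (d i))) (V := V)
      (fun i => (LinearMap.ker (d i)).subtype) (fun i => (d i).codRestrict _ (hg i))
      (fun i => Subtype.val_injective) (fun i x => ?_) (fun i x => ?_) (fun i h => ?_) hV 0)
      e.toLinearMap e.symm.toLinearMap e.symm_apply_apply
    · exact ⟨fun hx => ⟨⟨x, congrArg Subtype.val hx⟩, rfl⟩,
        fun ⟨y, hy⟩ => Subtype.ext (hy ▸ y.2)⟩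
    · obtain ⟨y, hy⟩ := (hd i x.1).1 x.2
      exact ⟨y, Subtype.ext hy⟩
    -- Exactness under `Hom_S(C, -)` is what lifts a map from `C` into a syzygy to the preceding
    -- term.
    · let h' : C →ₗ[S] LinearMap.ker (d (i + 1)) := h
      obtain ⟨k, hk⟩ := (hCd i ((LinearMap.ker (d (i + 1))).subtype.comp h')).1
        (LinearMap.ext fun c => (h' c).2)
      exact ⟨k, LinearMap.ext fun c => Subtype.ext (LinearMap.congr_fun hk c)⟩
  · intro hN
    exact ⟨fun i => ModuleCat.of S (DiskTerm N i), diskDifferential S N, hN.diskTerm,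
      diskDifferential_exact, diskDifferential_comp_exact, ⟨diskKernelEquiv S N⟩⟩

end CompleteKernels

end FoxbyBass

theorem theorem4p8 (R S : Type u) [Ring R] [Ring S] (C : Type u) [AddCommGroup C] [Module S C]
    [Module Rᵐᵒᵖ C] [SMulCommClass S Rᵐᵒᵖ C]
    (hC : FoxbyBass.IsFaithfullySemidualizing R S C) (n : ℕ) (hn : 1 ≤ n) :
    FoxbyBass.iteratedClass C (FoxbyBass.BassClass R S C) n = FoxbyBass.BassClass R S C := by
  induction n, hn using Nat.le_induction with
  | base => rfl
  | succ n hn ih =>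
    -- The recursive clause of `iteratedClass` applies only from index 2 on.
    obtain ⟨n, rfl⟩ := Nat.exists_eq_add_of_le' hn
    rw [FoxbyBass.iteratedClass, ih, FoxbyBass.completeKernels_bassClass]
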